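/- For $f\in L^\infty([-\pi,\pi])$ (complex-valued) let $f_k=\frac1{2\pi}\int_{-\pi}^{\pi}f(x)e^{-\mathrm{i}kx}\,dx$, $k\in\mathbb Z$, be its Fourier coefficients, let $|||f|||^2=\sum_{k\in\mathbb Z}|k|\,|f_k|^2$, and for $n\ge 1$ let $T_n(f)=[f_{i-j}]_{i,j=1}^n$ be the $n$-th Toeplitz matrix generated by $f$, with singular values $\sigma_1(T_n(f)),\dots,\sigma_n(T_n(f))$ counted with multiplicity. **Theorem.** Let $f\in L^\infty([-\pi,\pi])$ with $|||f|||^2<\infty$, and let $G:\mathbb R\to\mathbb C$ be three times continuously differentiable with compact support. Then, for every $n\ge 1$, $$\left|\sum_{j=1}^n G\bigl(\sigma_j(T_n(f))^2\bigr)-\frac{n}{2\pi}\int_{-\pi}^{\pi}G\bigl(|f(\theta)|^2\bigr)\,d\theta\right|\le 2\,|||f|||^2\left[c_1+2c_2\|f\|_\infty^2\right],$$ where $c_1=2\|G'\|_1+\sqrt2\,\|G''\|_2$ and $c_2=2\|G''\|_1+\sqrt2\,\|G'''\|_2$. Here $\|f\|_\infty$ is the essential supremum of $|f|$ on $[-\pi,\pi]$,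 and $\|\cdot\|_1$, $\|\cdot\|_2$ are the $L^1$ and $L^2$ norms on $\mathbb R$ with respect to Lebesgue measure. -/

import Mathlib

open MeasureTheory

/-- The interval `[-π, π]` has positive length. -/
theorem neg_pi_lt_pi : -Real.pi < Real.pi := by
  linarith [Real.pi_pos]

/-- The `k`-th Fourier coefficient of `f` on `[-π, π]`. -/
noncomputable def symbolCoeff (f : ℝ → ℂ) (k : ℤ) : ℂ :=
  fourierCoeffOn neg_pi_lt_pi f k

/-- The Fourier coefficient is `(1 / 2π) ∫_{-π}^{π} f(x) e^{-ikx} dx`. -/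
theorem symbolCoeff_eq (f : ℝ → ℂ) (k : ℤ) :
    symbolCoeff f k =
      1 / (2 * Real.pi) *
        ∫ x in (-Real.pi)..Real.pi, f x * Complex.exp (-(Complex.I * k * x)) := by
  have hp : (Real.pi : ℂ) ≠ 0 := by exact_mod_cast Real.pi_ne_zero
  rw [symbolCoeff, fourierCoeffOn_eq_integral, Complex.real_smul]
  congr 1
  · push_cast
    ring
  · refine intervalIntegral.integral_congr fun x _ => ?_
    simp only [fourier_coe_apply, smul_eq_mul]
    rw [mul_comm]
    congr 2
    push_cast
    field_simp
    ring

/-- The `n`-th Toeplitz matrix generated by `f`: its `(i, j)` entry is `f_{i-j}`. -/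
noncomputable def toeplitzMatrix (n : ℕ) (f : ℝ → ℂ) : Matrix (Fin n) (Fin n) ℂ :=
  Matrix.of fun i j => symbolCoeff f ((i : ℤ) - (j : ℤ))

/-- The singular values of a complex `n × n` matrix, counted with multiplicity and in
nonincreasing order, indexed from `0` to `n - 1`. -/
noncomputable def matrixSingularValue {n : ℕ} (A : Matrix (Fin n) (Fin n) ℂ) (j : Fin n) : ℝ :=
  (Matrix.toEuclideanLin A).singularValues j

/-- The terms `|k| |f_k|²`, `k ∈ ℤ`, of the series defining the squared seminorm of `f`. -/
noncomputable def seminormTerm (f : ℝ → ℂ) (k : ℤ) : ℝ :=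
  |(k : ℝ)| * ‖symbolCoeff f k‖ ^ 2

/-- The sum of `|k| |f_k|²` over all integers `k`; meaningful when `seminormTerm f` is summable. -/
noncomputable def seminormSq (f : ℝ → ℂ) : ℝ :=
  ∑' k : ℤ, seminormTerm f k

/-- The essential supremum of `|f|` on `[-π, π]`. -/
noncomputable def supNorm (f : ℝ → ℂ) : ℝ :=
  (eLpNorm f ⊤ (volume.restrict (Set.Icc (-Real.pi) Real.pi))).toReal

/-- `c₁ = 2 ‖G'‖₁ + √2 ‖G''‖₂`, norms over `ℝ`. -/
noncomputable def constC1 (G : ℝ → ℂ) : ℝ :=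
  2 * (eLpNorm (iteratedDeriv 1 G) 1 volume).toReal
    + Real.sqrt 2 * (eLpNorm (iteratedDeriv 2 G) 2 volume).toReal

/-- `c₂ = 2 ‖G''‖₁ + √2 ‖G'''‖₂`, norms over `ℝ`. -/
noncomputable def constC2 (G : ℝ → ℂ) : ℝ :=
  2 * (eLpNorm (iteratedDeriv 2 G) 1 volume).toReal
    + Real.sqrt 2 * (eLpNorm (iteratedDeriv 3 G) 2 volume).toReal

/-! Let `u_j` be an orthonormal eigenbasis of `T* T`, `T = T_n(f)`, with eigenvalues `σ_j²`, and
`p_j` the trigonometric polynomial with coefficient vector `u_j`. Since `∑ |p_j|² = n` pointwise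
(`sum_norm_sq_trigPoly`), the integral term is the sum over `j` of the averages of `G(|f|²)` against
the probability densities `|p_j|²`. Each average is compared with `G(σ_j²)` by a Taylor expansion at
`σ_j²`.

Both moments of `|f|² - σ_j²` are controlled by the energy of `f p_j` and `conj f · p_{T u_j}`
outside the frequencies `[0, n)`: the first moment equals the off-band energy of `f p_j`, because `T
u_j` is its in-band part, and the second is bounded in
`integral_sq_norm_sq_sub_mul_norm_sq_trigPoly_le`. Summed over `j`, off-band energies become squared
Hilbert–Schmidt norms, bounded by `|||f|||²` and `‖f‖_∞² |||f|||²` (`sum_offBand_le`): the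
coefficient `f_m` leaves the band from at most `|m|` positions. -/

/-! ### Sup bounds for `G'` and `G''`, and the Taylor estimate. -/

/-- A `C¹` function with compact support is bounded by `‖g‖₁ + ‖g'‖₂`. -/
theorem norm_le_eLpNorm_one_add_eLpNorm_two_deriv {g : ℝ → ℂ} (hg : ContDiff ℝ 1 g)
    (hc : HasCompactSupport g) (x : ℝ) :
    ‖g x‖ ≤ (eLpNorm g 1 volume).toReal + (eLpNorm (deriv g) 2 volume).toReal := by
  have hdc : Continuous (deriv g) := hg.continuous_deriv le_rfl
  have hgi : Integrable g := hg.continuous.integrable_of_hasCompactSupport hc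
  have hd2 : MemLp (deriv g) 2 volume := hdc.memLp_of_hasCompactSupport hc.deriv
  have hdi : Integrable (deriv g) := hdc.integrable_of_hasCompactSupport hc.deriv
  -- Averaging over an interval of length one makes `μ` a probability measure, so the `L¹` norm of
  -- `g'` on it is at most its `L²` norm.
  set μ : Measure ℝ := volume.restrict (Set.Ioc x (x + 1)) with hμ
  have : IsProbabilityMeasure μ := ⟨by simp [hμ]⟩
  have h1 : ∫ y, ‖g y‖ ∂μ ≤ (eLpNorm g 1 volume).toReal := by
    rw [eLpNorm_one_eq_lintegral_enorm, ← integral_norm_eq_lintegral_enorm hgi.1]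
    exact setIntegral_le_integral hgi.norm (Filter.Eventually.of_forall fun y => norm_nonneg _)
  have h2 : ∫ y, ‖deriv g y‖ ∂μ ≤ (eLpNorm (deriv g) 2 volume).toReal := by
    rw [integral_norm_eq_lintegral_enorm hdi.1.restrict, ← eLpNorm_one_eq_lintegral_enorm]
    refine ENNReal.toReal_mono hd2.eLpNorm_ne_top ?_
    exact (eLpNorm_le_eLpNorm_of_exponent_le (by norm_num) hdi.1.restrict).trans
      (eLpNorm_mono_measure _ Measure.restrict_le_self)
  have key : ∀ y ∈ Set.Ioc x (x + 1), ‖g x‖ ≤ ‖g y‖ + ∫ z, ‖deriv g z‖ ∂μ := by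
    intro y hy
    have e : ∫ z in x..y, deriv g z = g y - g x :=
      intervalIntegral.integral_deriv_eq_sub (fun z _ => hg.differentiable one_ne_zero z)
        (hdc.intervalIntegrable _ _)
    have b : ‖g y - g x‖ ≤ ∫ z, ‖deriv g z‖ ∂μ := by
      rw [← e, intervalIntegral.integral_of_le hy.1.le]
      refine (norm_integral_le_integral_norm _).trans ?_
      exact setIntegral_mono_set hdi.norm.integrableOn
        (Filter.Eventually.of_forall fun y => norm_nonneg _)
        (Set.Ioc_subset_Ioc_right hy.2).eventuallyLE
    have t := norm_sub_norm_le (g x) (g y)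
    rw [norm_sub_rev] at t
    linarith
  have h3 : ∫ _, ‖g x‖ ∂μ ≤ ∫ y, (‖g y‖ + ∫ z, ‖deriv g z‖ ∂μ) ∂μ :=
    setIntegral_mono_on (by simp) (hgi.norm.restrict.add (integrable_const _))
      measurableSet_Ioc key
  rw [integral_add hgi.norm.restrict (integrable_const _)] at h3
  simp only [integral_const, probReal_univ, one_smul] at h3
  linarith

/-- The factors `2` and `√2` in `constC1` are only needed to be at least `1`. -/
theorem norm_deriv_le_constC1 {G : ℝ → ℂ} (hG : ContDiff ℝ 3 G) (hGc : HasCompactSupport G)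
    (x : ℝ) : ‖deriv G x‖ ≤ constC1 G := by
  have hd : ContDiff ℝ 1 (deriv G) :=
    (contDiff_succ_iff_deriv (n := 2).1 (by exact_mod_cast hG)).2.2.of_le (by norm_num)
  have h := norm_le_eLpNorm_one_add_eLpNorm_two_deriv hd hGc.deriv x
  have e2 : iteratedDeriv 2 G = deriv (deriv G) := by
    rw [iteratedDeriv_succ, iteratedDeriv_one]
  rw [constC1, e2, iteratedDeriv_one]
  have s : 1 ≤ Real.sqrt 2 := by rw [Real.one_le_sqrt]; norm_num
  nlinarith [ENNReal.toReal_nonneg (a := eLpNorm (deriv G) 1 volume),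
    ENNReal.toReal_nonneg (a := eLpNorm (deriv (deriv G)) 2 volume)]

theorem norm_deriv_deriv_le_constC2 {G : ℝ → ℂ} (hG : ContDiff ℝ 3 G)
    (hGc : HasCompactSupport G) (x : ℝ) : ‖deriv (deriv G) x‖ ≤ constC2 G := by
  have hd : ContDiff ℝ 2 (deriv G) :=
    (contDiff_succ_iff_deriv (n := 2).1 (by exact_mod_cast hG)).2.2
  have hdd : ContDiff ℝ 1 (deriv (deriv G)) :=
    (contDiff_succ_iff_deriv (n := 1).1 (by exact_mod_cast hd)).2.2
  have h := norm_le_eLpNorm_one_add_eLpNorm_two_deriv hdd hGc.deriv.deriv x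
  have e2 : iteratedDeriv 2 G = deriv (deriv G) := by
    rw [iteratedDeriv_succ, iteratedDeriv_one]
  have e3 : iteratedDeriv 3 G = deriv (deriv (deriv G)) := by
    rw [iteratedDeriv_succ, e2]
  rw [constC2, e2, e3]
  have s : 1 ≤ Real.sqrt 2 := by rw [Real.one_le_sqrt]; norm_num
  nlinarith [ENNReal.toReal_nonneg (a := eLpNorm (deriv (deriv G)) 1 volume),
    ENNReal.toReal_nonneg (a := eLpNorm (deriv (deriv (deriv G))) 2 volume)]

/-- First order Taylor estimate with a uniform bound on the second derivative. -/
theorem norm_sub_sub_smul_deriv_le {G : ℝ → ℂ} (hG : ContDiff ℝ 2 G) {M : ℝ}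
    (hM : ∀ x, ‖deriv (deriv G) x‖ ≤ M) (x y : ℝ) :
    ‖G x - G y - (x - y) • deriv G y‖ ≤ M * (x - y) ^ 2 := by
  have hd : ContDiff ℝ 1 (deriv G) :=
    (contDiff_succ_iff_deriv (n := 1).1 (by exact_mod_cast hG)).2.2
  have hM0 : 0 ≤ M := (norm_nonneg _).trans (hM 0)
  have lip : ∀ z, ‖deriv G z - deriv G y‖ ≤ M * ‖z - y‖ := fun z =>
    convex_univ.norm_image_sub_le_of_norm_deriv_le
      (fun w _ => hd.differentiable one_ne_zero w) (fun w _ => hM w) trivial trivial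
  have hder : ∀ z, HasDerivAt (fun w : ℝ => G w - (w - y) • deriv G y)
      (deriv G z - deriv G y) z := by
    intro z
    have h1 := (hG.differentiable two_ne_zero z).hasDerivAt
    have h2 := ((hasDerivAt_id z).sub_const y).smul_const (deriv G y)
    simpa using h1.fun_sub h2
  -- The mean value inequality is applied to `G` minus its tangent at `y`; it yields `M` rather than
  -- the sharp `M / 2`, which suffices here.
  have h := (convex_uIcc y x).norm_image_sub_le_of_norm_hasDerivWithin_le (C := M * |x - y|)
    (fun z _ => (hder z).hasDerivWithinAt) (fun z hz => (lip z).trans ?_)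
    (Set.left_mem_uIcc) (Set.right_mem_uIcc)
  · simp only [sub_self, zero_smul, sub_zero, Real.norm_eq_abs] at h
    have e : G x - (x - y) • deriv G y - G y = G x - G y - (x - y) • deriv G y := by ring
    rw [e, mul_assoc, abs_mul_abs_self] at h
    rwa [sq]
  · exact mul_le_mul_of_nonneg_left (Set.abs_sub_left_of_mem_uIcc hz) hM0

/-! ### Fourier coefficients with respect to the normalized measure. -/

/-- Normalized Lebesgue measure on `(-π, π]`. -/
noncomputable def normalizedMeasure : Measure ℝ :=
  ENNReal.ofReal (2 * Real.pi)⁻¹ • volume.restrict (Set.Ioc (-Real.pi) Real.pi)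

instance isProbabilityMeasure_normalizedMeasure : IsProbabilityMeasure normalizedMeasure := by
  constructor
  have h : Real.pi - -Real.pi = 2 * Real.pi := by ring
  have hp := Real.pi_pos
  rw [normalizedMeasure, Measure.smul_apply, Measure.restrict_apply_univ, Real.volume_Ioc, h,
    smul_eq_mul, ← ENNReal.ofReal_mul (by positivity), inv_mul_cancel₀ (by positivity),
    ENNReal.ofReal_one]

theorem integral_normalizedMeasure {E : Type*} [NormedAddCommGroup E] [NormedSpace ℝ E]
    (φ : ℝ → E) : ∫ x, φ x ∂normalizedMeasure =
      (2 * Real.pi)⁻¹ • ∫ x in (-Real.pi)..Real.pi, φ x := by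
  have hp := Real.pi_pos
  rw [normalizedMeasure, integral_smul_measure, ENNReal.toReal_ofReal (by positivity),
    intervalIntegral.integral_of_le neg_pi_lt_pi.le]

theorem normalizedMeasure_smul :
    volume.restrict (Set.Ioc (-Real.pi) Real.pi) =
      ENNReal.ofReal (2 * Real.pi) • normalizedMeasure := by
  have hp := Real.pi_pos
  rw [normalizedMeasure, smul_smul, ← ENNReal.ofReal_mul (by positivity),
    mul_inv_cancel₀ (by positivity), ENNReal.ofReal_one, one_smul]

theorem normalizedMeasure_absolutelyContinuous :
    normalizedMeasure ≪ volume.restrict (Set.Icc (-Real.pi) Real.pi) := by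
  rw [normalizedMeasure, Measure.restrict_congr_set Ioc_ae_eq_Icc]
  exact Measure.smul_absolutelyContinuous

theorem ae_norm_le_supNorm {f : ℝ → ℂ}
    (hf : MemLp f ⊤ (volume.restrict (Set.Icc (-Real.pi) Real.pi))) :
    ∀ᵐ x ∂normalizedMeasure, ‖f x‖ ≤ supNorm f := by
  refine normalizedMeasure_absolutelyContinuous.ae_le ?_
  have h := ae_le_eLpNormEssSup (f := f) (μ := volume.restrict (Set.Icc (-Real.pi) Real.pi))
  filter_upwards [h] with x hx
  rw [supNorm, eLpNorm_exponent_top, ← toReal_enorm]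
  exact ENNReal.toReal_mono (by simpa using hf.eLpNorm_ne_top) hx

theorem memLp_top_normalizedMeasure {f : ℝ → ℂ}
    (hf : MemLp f ⊤ (volume.restrict (Set.Icc (-Real.pi) Real.pi))) :
    MemLp f ⊤ normalizedMeasure :=
  memLp_top_of_bound (hf.1.mono_ac normalizedMeasure_absolutelyContinuous) _ (ae_norm_le_supNorm hf)

/-- The Fourier coefficients as integrals against the normalized measure. -/
theorem symbolCoeff_eq_integral (f : ℝ → ℂ) (k : ℤ) :
    symbolCoeff f k = ∫ x, f x * Complex.exp (-(Complex.I * k * x)) ∂normalizedMeasure := by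
  rw [symbolCoeff_eq, integral_normalizedMeasure, Complex.real_smul]
  push_cast
  rw [one_div]

/-- Parseval's identity. -/
theorem hasSum_norm_sq_symbolCoeff {f : ℝ → ℂ} (hf : MemLp f 2 normalizedMeasure) :
    HasSum (fun k => ‖symbolCoeff f k‖ ^ 2) (∫ x, ‖f x‖ ^ 2 ∂normalizedMeasure) := by
  have h := hasSum_sq_fourierCoeffOn neg_pi_lt_pi (f := f)
    (by rw [normalizedMeasure_smul]; exact hf.smul_measure ENNReal.ofReal_ne_top)
  have e : Real.pi - -Real.pi = 2 * Real.pi := by ring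
  rw [e] at h
  rw [integral_normalizedMeasure]
  exact h

theorem integrable_mul_exp {g : ℝ → ℂ} (hg : MemLp g ⊤ normalizedMeasure) (c : ℂ) :
    Integrable (fun x : ℝ => g x * Complex.exp (Complex.I * c * x)) normalizedMeasure := by
  have h : Integrable (fun x : ℝ => Complex.exp (Complex.I * c * x)) normalizedMeasure := by
    have hc : Continuous fun x : ℝ => Complex.exp (Complex.I * c * x) := by fun_prop
    exact (hc.integrableOn_Ioc).smul_measure ENNReal.ofReal_ne_top
  exact h.mul_of_top_right hg

theorem symbolCoeff_sub {g₁ g₂ : ℝ → ℂ} (h₁ : MemLp g₁ ⊤ normalizedMeasure)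
    (h₂ : MemLp g₂ ⊤ normalizedMeasure) (k : ℤ) :
    symbolCoeff (fun x => g₁ x - g₂ x) k = symbolCoeff g₁ k - symbolCoeff g₂ k := by
  simp only [symbolCoeff_eq_integral, sub_mul, ← mul_neg]
  have i₁ := integrable_mul_exp h₁ (-k)
  have i₂ := integrable_mul_exp h₂ (-k)
  simp only [mul_neg, neg_mul] at i₁ i₂ ⊢
  exact integral_sub i₁ i₂

theorem symbolCoeff_star (f : ℝ → ℂ) (k : ℤ) :
    symbolCoeff (star f) k = star (symbolCoeff f (-k)) := by
  simp only [symbolCoeff_eq_integral, Complex.star_def, ← integral_conj, Pi.star_apply]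
  congr 1
  ext x
  rw [map_mul, ← Complex.exp_conj]
  simp

theorem symbolCoeff_one (k : ℤ) : symbolCoeff (fun _ => 1) k = if k = 0 then 1 else 0 := by
  rw [symbolCoeff_eq]
  split_ifs with hk
  · subst hk
    have hp : (Real.pi : ℂ) ≠ 0 := by exact_mod_cast Real.pi_ne_zero
    simp
    field_simp
    ring
  · have hk' : -(Complex.I * k) ≠ 0 := by simp [hk]
    have e : ∀ x : ℝ, (1 : ℂ) * Complex.exp (-(Complex.I * k * x)) =
        Complex.exp (-(Complex.I * k) * x) := fun x => by rw [one_mul, neg_mul]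
    simp only [e]
    rw [integral_exp_mul_complex hk']
    have : Complex.exp (-(Complex.I * k) * Real.pi) =
        Complex.exp (-(Complex.I * k) * (-Real.pi : ℝ)) := by
      rw [Complex.exp_eq_exp_iff_exists_int]
      exact ⟨-k, by push_cast; ring⟩
    rw [this, sub_self, zero_div, mul_zero]

/-! ### Trigonometric polynomials and the Toeplitz operator. -/

/-- The trigonometric polynomial `∑ u_k e^{ikx}`. -/
noncomputable def trigPoly {n : ℕ} (u : EuclideanSpace ℂ (Fin n)) (x : ℝ) : ℂ :=
  ∑ k : Fin n, u k * Complex.exp (Complex.I * (k : ℂ) * x)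

theorem continuous_trigPoly {n : ℕ} (u : EuclideanSpace ℂ (Fin n)) : Continuous (trigPoly u) := by
  unfold trigPoly
  fun_prop

theorem trigPoly_smul {n : ℕ} (c : ℂ) (u : EuclideanSpace ℂ (Fin n)) (x : ℝ) :
    trigPoly (c • u) x = c * trigPoly u x := by
  simp [trigPoly, Finset.mul_sum, mul_assoc]

theorem memLp_top_trigPoly {n : ℕ} (u : EuclideanSpace ℂ (Fin n)) :
    MemLp (trigPoly u) ⊤ normalizedMeasure := by
  refine memLp_top_of_bound (continuous_trigPoly u).aestronglyMeasurable (∑ k, ‖u k‖)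
    (Filter.Eventually.of_forall fun x => (norm_sum_le _ _).trans (Finset.sum_le_sum fun k _ => ?_))
  have : Complex.I * (k : ℂ) * x = ((k : ℝ) * x : ℝ) * Complex.I := by push_cast; ring
  rw [norm_mul, this, Complex.norm_exp_ofReal_mul_I, mul_one]

theorem trigPoly_eq_inner {n : ℕ} (u : EuclideanSpace ℂ (Fin n)) (x : ℝ) :
    trigPoly u x = inner ℂ (WithLp.toLp 2 fun k : Fin n =>
      Complex.exp (-(Complex.I * (k : ℂ) * x))) u := by
  simp [trigPoly, PiLp.inner_apply, ← Complex.exp_conj]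

/-- Evaluation at `x` is the inner product with a vector of `n` unimodular entries; Parseval in the
basis `b` gives its squared norm. -/
theorem sum_norm_sq_trigPoly {n : ℕ} (b : OrthonormalBasis (Fin n) ℂ (EuclideanSpace ℂ (Fin n)))
    (x : ℝ) : ∑ j, ‖trigPoly (b j) x‖ ^ 2 = n := by
  simp only [trigPoly_eq_inner]
  rw [b.sum_sq_norm_inner_left, EuclideanSpace.norm_sq_eq]
  have (k : Fin n) : -(Complex.I * (k : ℂ) * x) = (-(k : ℝ) * x : ℝ) * Complex.I := by
    push_cast; ring
  simp only [this, Complex.norm_exp_ofReal_mul_I]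
  simp

/-- The Fourier coefficients of `g p_u` are given by convolution. -/
theorem symbolCoeff_mul_trigPoly {g : ℝ → ℂ} (hg : MemLp g ⊤ normalizedMeasure) {n : ℕ}
    (u : EuclideanSpace ℂ (Fin n)) (l : ℤ) :
    symbolCoeff (fun x => g x * trigPoly u x) l =
      ∑ k : Fin n, symbolCoeff g (l - (k : ℤ)) * u k := by
  simp only [symbolCoeff_eq_integral, ← integral_mul_const]
  rw [← integral_finsetSum]
  · congr 1
    ext x
    simp only [trigPoly, Finset.mul_sum, Finset.sum_mul]
    refine Finset.sum_congr rfl fun k _ => ?_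
    have : Complex.exp (-(Complex.I * ((l - (k : ℤ) : ℤ) : ℂ) * x)) =
        Complex.exp (Complex.I * (k : ℂ) * x) * Complex.exp (-(Complex.I * l * x)) := by
      rw [← Complex.exp_add]
      congr 1
      push_cast
      ring
    rw [this]
    ring
  · intro k _
    have h := (integrable_mul_exp hg (-((l - (k : ℤ) : ℤ) : ℂ))).mul_const (u k)
    simpa only [mul_neg, neg_mul] using h

/-- The Toeplitz operator on `ℂⁿ`. -/
noncomputable abbrev toeplitzOp (n : ℕ) (g : ℝ → ℂ) :
    EuclideanSpace ℂ (Fin n) →ₗ[ℂ] EuclideanSpace ℂ (Fin n) :=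
  Matrix.toEuclideanLin (toeplitzMatrix n g)

theorem toeplitzOp_apply {n : ℕ} (g : ℝ → ℂ) (u : EuclideanSpace ℂ (Fin n)) (i : Fin n) :
    toeplitzOp n g u i = ∑ k : Fin n, symbolCoeff g ((i : ℤ) - (k : ℤ)) * u k := by
  simp [toeplitzOp, toeplitzMatrix, Matrix.toLpLin_apply, Matrix.mulVec, dotProduct]

theorem toeplitzOp_star {n : ℕ} (g : ℝ → ℂ) :
    toeplitzOp n (star g) = (toeplitzOp n g).adjoint := by
  rw [toeplitzOp, toeplitzOp, ← Matrix.toEuclideanLin_conjTranspose_eq_adjoint]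
  congr 1
  ext i j
  simp [toeplitzMatrix, symbolCoeff_star]

/-! ### Energy inside and outside the frequency band. -/

/-- Keep the values of a sequence outside the window `[0, n)`. -/
def outside (n : ℕ) (a : ℤ → ℝ) (l : ℤ) : ℝ :=
  if 0 ≤ l ∧ l < n then 0 else a l

theorem outside_nonneg {n : ℕ} {a : ℤ → ℝ} (ha : ∀ l, 0 ≤ a l) (l : ℤ) : 0 ≤ outside n a l := by
  unfold outside; split_ifs
  exacts [le_rfl, ha l]

theorem outside_le {n : ℕ} {a : ℤ → ℝ} (ha : ∀ l, 0 ≤ a l) (l : ℤ) : outside n a l ≤ a l := by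
  unfold outside; split_ifs
  exacts [ha l, le_rfl]

theorem summable_outside {n : ℕ} {a : ℤ → ℝ} (ha : ∀ l, 0 ≤ a l) (hs : Summable a) :
    Summable (outside n a) :=
  hs.of_nonneg_of_le (outside_nonneg ha) (outside_le ha)

theorem outside_mono {n : ℕ} {a b : ℤ → ℝ} (h : ∀ l, a l ≤ b l) (l : ℤ) :
    outside n a l ≤ outside n b l := by
  unfold outside; split_ifs
  exacts [le_rfl, h l]

theorem outside_sum {n : ℕ} {ι : Type*} (s : Finset ι) (a : ι → ℤ → ℝ) (l : ℤ) :
    outside n (fun l => ∑ j ∈ s, a j l) l = ∑ j ∈ s, outside n (a j) l := by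
  unfold outside; split_ifs <;> simp

theorem outside_const_mul {n : ℕ} (c : ℝ) (a : ℤ → ℝ) (l : ℤ) :
    outside n (fun l => c * a l) l = c * outside n a l := by
  unfold outside; split_ifs <;> simp

theorem tsum_eq_sum_add_tsum_outside {n : ℕ} {a : ℤ → ℝ} (ha : ∀ l, 0 ≤ a l) (hs : Summable a) :
    ∑' l, a l = ∑ i : Fin n, a (i : ℤ) + ∑' l, outside n a l := by
  have h1 : ∑' l, (a l - outside n a l) = ∑ i : Fin n, a (i : ℤ) := by
    have e : ∑ i : Fin n, a (i : ℤ) = ∑ l ∈ Finset.Ico (0 : ℤ) n, a l := by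
      refine Finset.sum_bij (fun i _ => (i : ℤ)) (fun i _ => by simp) (fun i _ j _ h => ?_)
        (fun l hl => ?_) (fun i _ => rfl)
      · exact Fin.ext (by exact_mod_cast h)
      · rw [Finset.mem_Ico] at hl
        exact ⟨⟨l.toNat, by omega⟩, Finset.mem_univ _, by simp [hl.1]⟩
    rw [e, tsum_eq_sum (s := Finset.Ico (0 : ℤ) n)]
    · refine Finset.sum_congr rfl fun l hl => ?_
      rw [Finset.mem_Ico] at hl
      simp [outside, hl]
    · intro l hl
      rw [Finset.mem_Ico] at hl
      simp [outside, hl]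
  rw [← h1, (hs.tsum_sub (summable_outside ha hs))]
  ring

/-- The squared norm of the part of `g p_u` with frequencies outside `[0, n)`. -/
noncomputable def offBand {n : ℕ} (g : ℝ → ℂ) (u : EuclideanSpace ℂ (Fin n)) : ℝ :=
  ∑' l, outside n (fun l => ‖∑ k : Fin n, symbolCoeff g (l - (k : ℤ)) * u k‖ ^ 2) l

theorem offBand_nonneg {n : ℕ} (g : ℝ → ℂ) (u : EuclideanSpace ℂ (Fin n)) : 0 ≤ offBand g u :=
  tsum_nonneg (outside_nonneg fun _ => by positivity)

theorem memLp_top_mul {g h : ℝ → ℂ} (hg : MemLp g ⊤ normalizedMeasure)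
    (hh : MemLp h ⊤ normalizedMeasure) : MemLp (fun x => g x * h x) ⊤ normalizedMeasure :=
  hh.mul hg

theorem summable_norm_sq_convolution {g : ℝ → ℂ} (hg : MemLp g ⊤ normalizedMeasure) {n : ℕ}
    (u : EuclideanSpace ℂ (Fin n)) :
    Summable fun l : ℤ => ‖∑ k : Fin n, symbolCoeff g (l - (k : ℤ)) * u k‖ ^ 2 := by
  have h := (hasSum_norm_sq_symbolCoeff
    ((memLp_top_mul hg (memLp_top_trigPoly u)).mono_exponent le_top)).summable
  simpa only [symbolCoeff_mul_trigPoly hg] using h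

/-- The Fourier coefficients of `g p_u` at frequencies in `[0, n)` are the entries of `T u`, so
Parseval splits along the band. -/
theorem integral_norm_sq_mul_trigPoly {g : ℝ → ℂ} (hg : MemLp g ⊤ normalizedMeasure) {n : ℕ}
    (u : EuclideanSpace ℂ (Fin n)) :
    ∫ x, ‖g x * trigPoly u x‖ ^ 2 ∂normalizedMeasure =
      ‖toeplitzOp n g u‖ ^ 2 + offBand g u := by
  have h := hasSum_norm_sq_symbolCoeff
    ((memLp_top_mul hg (memLp_top_trigPoly u)).mono_exponent (p := 2) le_top)
  simp only [symbolCoeff_mul_trigPoly hg] at h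
  rw [← h.tsum_eq, tsum_eq_sum_add_tsum_outside (n := n) (fun _ => by positivity) h.summable,
    EuclideanSpace.norm_sq_eq]
  simp only [toeplitzOp_apply, offBand]

theorem symbolCoeff_trigPoly {n : ℕ} (u : EuclideanSpace ℂ (Fin n)) (l : ℤ) :
    symbolCoeff (trigPoly u) l = ∑ k : Fin n, if l = (k : ℤ) then u k else 0 := by
  have h := symbolCoeff_mul_trigPoly (memLp_const 1) u l
  simp only [one_mul, symbolCoeff_one, sub_eq_zero, ite_mul, zero_mul] at h
  exact h

theorem symbolCoeff_trigPoly_fin {n : ℕ} (u : EuclideanSpace ℂ (Fin n)) (i : Fin n) :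
    symbolCoeff (trigPoly u) (i : ℤ) = u i := by
  rw [symbolCoeff_trigPoly]
  simp [Fin.val_inj]

theorem symbolCoeff_trigPoly_outside {n : ℕ} (u : EuclideanSpace ℂ (Fin n)) {l : ℤ}
    (hl : ¬ (0 ≤ l ∧ l < n)) : symbolCoeff (trigPoly u) l = 0 := by
  rw [symbolCoeff_trigPoly]
  refine Finset.sum_eq_zero fun k _ => if_neg ?_
  rintro rfl
  exact hl ⟨by positivity, by exact_mod_cast k.2⟩

/-- The remainder `g p_u - p_{T u}` has squared norm `offBand g u`. -/
theorem integral_norm_sq_mul_trigPoly_sub {g : ℝ → ℂ} (hg : MemLp g ⊤ normalizedMeasure) {n : ℕ}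
    (u : EuclideanSpace ℂ (Fin n)) :
    ∫ x, ‖g x * trigPoly u x - trigPoly (toeplitzOp n g u) x‖ ^ 2 ∂normalizedMeasure =
      offBand g u := by
  have hm := memLp_top_mul hg (memLp_top_trigPoly u)
  have hw := memLp_top_trigPoly (toeplitzOp n g u)
  have h := hasSum_norm_sq_symbolCoeff ((hm.sub hw).mono_exponent (p := 2) le_top)
  have e : ∀ l, ‖symbolCoeff ((fun x => g x * trigPoly u x) - trigPoly (toeplitzOp n g u)) l‖ ^ 2
      = outside n (fun l => ‖∑ k : Fin n, symbolCoeff g (l - (k : ℤ)) * u k‖ ^ 2) l := by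
    intro l
    have e1 := symbolCoeff_sub hm hw l
    rw [symbolCoeff_mul_trigPoly hg] at e1
    change ‖symbolCoeff (fun x => g x * trigPoly u x - trigPoly (toeplitzOp n g u) x) l‖ ^ 2 = _
    rw [e1]
    unfold outside
    split_ifs with hl
    · obtain ⟨i, rfl⟩ : ∃ i : Fin n, (i : ℤ) = l := ⟨⟨l.toNat, by omega⟩, by simp [hl.1]⟩
      rw [symbolCoeff_trigPoly_fin, toeplitzOp_apply, sub_self]
      simp
    · rw [symbolCoeff_trigPoly_outside _ hl, sub_zero]
  simp only [e] at h
  exact h.tsum_eq.symm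

theorem integral_norm_sq_trigPoly {n : ℕ} (u : EuclideanSpace ℂ (Fin n)) :
    ∫ x, ‖trigPoly u x‖ ^ 2 ∂normalizedMeasure = ‖u‖ ^ 2 := by
  have h := hasSum_norm_sq_symbolCoeff ((memLp_top_trigPoly u).mono_exponent (p := 2) le_top)
  rw [← h.tsum_eq, tsum_eq_sum_add_tsum_outside (n := n) (fun _ => by positivity) h.summable,
    EuclideanSpace.norm_sq_eq]
  simp only [symbolCoeff_trigPoly_fin, add_eq_left]
  refine (tsum_congr fun l => ?_).trans tsum_zero
  unfold outside
  split_ifs with hl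
  · rfl
  · simp [symbolCoeff_trigPoly_outside u hl]

theorem norm_sq_toeplitzOp_le {g : ℝ → ℂ} (hg : MemLp g ⊤ normalizedMeasure) {F : ℝ}
    (hF : ∀ᵐ x ∂normalizedMeasure, ‖g x‖ ≤ F) {n : ℕ} (u : EuclideanSpace ℂ (Fin n)) :
    ‖toeplitzOp n g u‖ ^ 2 ≤ F ^ 2 * ‖u‖ ^ 2 := by
  have h := integral_norm_sq_mul_trigPoly hg u
  have hp2 := ((memLp_top_trigPoly u).mono_exponent (p := 2) le_top).integrable_norm_pow two_ne_zero
  have hg2 := ((memLp_top_mul hg (memLp_top_trigPoly u)).mono_exponent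
    (p := 2) le_top).integrable_norm_pow two_ne_zero
  have le : ∫ x, ‖g x * trigPoly u x‖ ^ 2 ∂normalizedMeasure ≤
      ∫ x, F ^ 2 * ‖trigPoly u x‖ ^ 2 ∂normalizedMeasure := by
    refine integral_mono_ae hg2 (hp2.const_mul _) ?_
    filter_upwards [hF] with x hx
    rw [norm_mul, mul_pow]
    gcongr
  rw [integral_const_mul, integral_norm_sq_trigPoly] at le
  linarith [offBand_nonneg g u]

/-! ### Summing off-band energies over an orthonormal basis. -/

theorem seminormTerm_nonneg (f : ℝ → ℂ) (k : ℤ) : 0 ≤ seminormTerm f k := by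
  unfold seminormTerm; positivity

theorem seminormTerm_star (f : ℝ → ℂ) (k : ℤ) : seminormTerm (star f) k = seminormTerm f (-k) := by
  simp [seminormTerm, symbolCoeff_star]

theorem summable_seminormTerm_star {f : ℝ → ℂ} (hs : Summable (seminormTerm f)) :
    Summable (seminormTerm (star f)) := by
  simp only [funext (seminormTerm_star f)]
  exact (Equiv.neg ℤ).summable_iff.2 hs

theorem seminormSq_star (f : ℝ → ℂ) : seminormSq (star f) = seminormSq f := by
  simp only [seminormSq, seminormTerm_star]
  exact (Equiv.neg ℤ).tsum_eq (seminormTerm f)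

/-- At most `|m|` indices of the window `[0, n)` leave it under translation by `m`. -/
theorem card_filter_add_notMem_le (n : ℕ) (m : ℤ) :
    (Finset.univ.filter fun k : Fin n => ¬ (0 ≤ m + (k : ℤ) ∧ m + (k : ℤ) < n)).card
      ≤ m.natAbs := by
  rcases le_total 0 m with hm | hm
  -- For `m ≥ 0` only the last `|m|` indices can leave; truncated subtraction covers `|m| > n`.
  · calc _ ≤ (Finset.Ico (n - m.natAbs) n).card := by
          refine Finset.card_le_card_of_injOn (fun k : Fin n => (k : ℕ)) (fun k hk => ?_)
            (fun i _ j _ h => Fin.ext h)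
          simp only [Finset.coe_filter, Finset.mem_univ, true_and, Set.mem_ofPred_eq] at hk
          simp only [Finset.coe_Ico, Set.mem_Ico]
          omega
      _ ≤ _ := by rw [Nat.card_Ico]; omega
  · calc _ ≤ (Finset.range m.natAbs).card := by
          refine Finset.card_le_card_of_injOn (fun k : Fin n => (k : ℕ)) (fun k hk => ?_)
            (fun i _ j _ h => Fin.ext h)
          simp only [Finset.coe_filter, Finset.mem_univ, true_and, Set.mem_ofPred_eq] at hk
          simp only [Finset.coe_range, Set.mem_Iio]
          omega
      _ ≤ _ := by simp

theorem sum_outside_translate_le (n : ℕ) {a : ℤ → ℝ} (ha : ∀ m, 0 ≤ a m) (m : ℤ) :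
    ∑ k : Fin n, outside n (fun l => a (l - (k : ℤ))) (m + (k : ℤ)) ≤ |(m : ℝ)| * a m := by
  have e : ∑ k : Fin n, outside n (fun l => a (l - (k : ℤ))) (m + (k : ℤ)) =
      (Finset.univ.filter fun k : Fin n => ¬ (0 ≤ m + (k : ℤ) ∧ m + (k : ℤ) < n)).card * a m := by
    rw [← nsmul_eq_mul, ← Finset.sum_const, Finset.sum_filter]
    refine Finset.sum_congr rfl fun k _ => ?_
    simp only [outside, add_sub_cancel_right, ite_not]
  rw [e]
  refine mul_le_mul_of_nonneg_right ?_ (ha m)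
  rw [← Int.cast_abs, Int.abs_eq_natAbs]
  exact_mod_cast card_filter_add_notMem_le n m

/-- Substituting `l = m + k` separately for each `k` groups the terms by diagonals, where `a m` is
counted at most `|m|` times. -/
theorem tsum_outside_sum_translate_le (n : ℕ) {a : ℤ → ℝ} (ha : ∀ m, 0 ≤ a m) (hsum : Summable a)
    (hs : Summable fun m : ℤ => |(m : ℝ)| * a m) :
    ∑' l, outside n (fun l => ∑ k : Fin n, a (l - (k : ℤ))) l ≤ ∑' m : ℤ, |(m : ℝ)| * a m := by
  have ho (k : Fin n) : Summable (outside n fun l => a (l - (k : ℤ))) :=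
    summable_outside (fun _ => ha _) ((Equiv.subRight (k : ℤ)).summable_iff.2 hsum)
  have ho' (k : Fin n) := (Equiv.addRight (k : ℤ)).summable_iff.2 (ho k)
  have le := Summable.tsum_le_tsum (f := fun m => ∑ k : Fin n,
    ((outside n fun l => a (l - (k : ℤ))) ∘ Equiv.addRight (k : ℤ)) m)
    (sum_outside_translate_le n ha) (summable_sum fun k _ => ho' k) hs
  refine le_of_eq_of_le ?_ le
  rw [Summable.tsum_finsetSum fun k _ => ho' k, tsum_congr (outside_sum _ _),
    Summable.tsum_finsetSum fun k _ => ho k]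
  exact Finset.sum_congr rfl fun k _ => ((Equiv.addRight (k : ℤ)).tsum_eq _).symm

theorem tsum_outside_sum_norm_sq_le {g : ℝ → ℂ} (hg : MemLp g ⊤ normalizedMeasure)
    (hs : Summable (seminormTerm g)) (n : ℕ) :
    ∑' l, outside n (fun l => ∑ k : Fin n, ‖symbolCoeff g (l - (k : ℤ))‖ ^ 2) l
      ≤ seminormSq g :=
  tsum_outside_sum_translate_le n (a := fun m => ‖symbolCoeff g m‖ ^ 2) (fun _ => by positivity)
    (hasSum_norm_sq_symbolCoeff (hg.mono_exponent le_top)).summable hs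

/-- Hilbert–Schmidt bound for the off-band part over an orthonormal basis. -/
theorem sum_offBand_le {g : ℝ → ℂ} (hg : MemLp g ⊤ normalizedMeasure)
    (hs : Summable (seminormTerm g)) {n : ℕ}
    (b : OrthonormalBasis (Fin n) ℂ (EuclideanSpace ℂ (Fin n)))
    (B : EuclideanSpace ℂ (Fin n) →ₗ[ℂ] EuclideanSpace ℂ (Fin n)) {C : ℝ} (hC : 0 ≤ C)
    (hB : ∀ y, ‖B.adjoint y‖ ^ 2 ≤ C * ‖y‖ ^ 2) :
    ∑ j, offBand g (B (b j)) ≤ C * seminormSq g := by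
  have hj (j : Fin n) := summable_outside (n := n) (fun _ => by positivity)
    (summable_norm_sq_convolution hg (B (b j)))
  have hsum := (hasSum_norm_sq_symbolCoeff (hg.mono_exponent le_top)).summable
  have hk (k : Fin n) : Summable fun l : ℤ => ‖symbolCoeff g (l - (k : ℤ))‖ ^ 2 :=
    (Equiv.subRight (k : ℤ)).summable_iff.2 hsum
  -- Row `l` acts as the inner product with `B* y`, so Parseval turns the sum over `j` into `‖B*
  -- y‖²`, to which `hB` applies.
  have row (l : ℤ) : ∑ j, ‖∑ k : Fin n, symbolCoeff g (l - (k : ℤ)) * B (b j) k‖ ^ 2 ≤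
      C * ∑ k : Fin n, ‖symbolCoeff g (l - (k : ℤ))‖ ^ 2 := by
    set y : EuclideanSpace ℂ (Fin n) :=
      WithLp.toLp 2 fun k : Fin n => star (symbolCoeff g (l - (k : ℤ))) with hy
    have e (j : Fin n) : ∑ k : Fin n, symbolCoeff g (l - (k : ℤ)) * B (b j) k =
        inner ℂ (B.adjoint y) (b j) := by
      rw [LinearMap.adjoint_inner_left]
      simp [hy, PiLp.inner_apply, mul_comm]
    simp only [e]
    rw [b.sum_sq_norm_inner_left]
    refine (hB y).trans_eq ?_
    rw [EuclideanSpace.norm_sq_eq]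
    simp [hy]
  simp only [offBand]
  rw [← Summable.tsum_finsetSum fun j _ => hj j]
  calc _ ≤ ∑' l, C * outside n (fun l => ∑ k : Fin n, ‖symbolCoeff g (l - (k : ℤ))‖ ^ 2) l := by
        refine Summable.tsum_le_tsum (fun l => ?_) (summable_sum fun j _ => hj j)
          ((summable_outside (fun _ => by positivity) (summable_sum fun k _ => hk k)).mul_left C)
        rw [← outside_sum, ← outside_const_mul]
        exact outside_mono row l
    _ ≤ _ := by
        rw [tsum_mul_left]
        exact mul_le_mul_of_nonneg_left (tsum_outside_sum_norm_sq_le hg hs n) hC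

/-! ### Moments of `|f|² - c` against `|p_u|²`. -/

theorem memLp_top_norm_sq_sub {f : ℝ → ℂ} (hf : MemLp f ⊤ normalizedMeasure) (c : ℝ) :
    MemLp (fun x => ((‖f x‖ ^ 2 - c : ℝ) : ℂ)) ⊤ normalizedMeasure := by
  have h := (memLp_top_mul hf.star hf).sub (memLp_const (c : ℂ))
  convert h using 2 with x
  simp [Complex.conj_mul']

/-- For a unit eigenvector `c = ‖T u‖²`, the in-band energy of `f p_u`; what remains after
subtracting it is off-band. -/
theorem integral_norm_sq_sub_mul_norm_sq_trigPoly {f : ℝ → ℂ} (hf : MemLp f ⊤ normalizedMeasure)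
    {n : ℕ} {u : EuclideanSpace ℂ (Fin n)} {c : ℝ} (hu : ‖u‖ = 1)
    (hc : (toeplitzOp n f).adjoint (toeplitzOp n f u) = (c : ℂ) • u) :
    ∫ x, (‖f x‖ ^ 2 - c) * ‖trigPoly u x‖ ^ 2 ∂normalizedMeasure = offBand f u := by
  have hT : ‖toeplitzOp n f u‖ ^ 2 = c := by
    have h : inner ℂ u ((toeplitzOp n f).adjoint (toeplitzOp n f u)) = (c : ℂ) := by
      rw [hc, inner_smul_right, inner_self_eq_norm_sq_to_K, hu]
      simp
    rw [LinearMap.adjoint_inner_right, inner_self_eq_norm_sq_to_K] at h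
    exact Complex.ofReal_injective (by simpa using h)
  have hp := ((memLp_top_trigPoly u).mono_exponent (p := 2) le_top).integrable_norm_pow two_ne_zero
  have hg := ((memLp_top_mul hf (memLp_top_trigPoly u)).mono_exponent
    (p := 2) le_top).integrable_norm_pow two_ne_zero
  have e : ∀ x, (‖f x‖ ^ 2 - c) * ‖trigPoly u x‖ ^ 2 =
      ‖f x * trigPoly u x‖ ^ 2 - c * ‖trigPoly u x‖ ^ 2 := fun x => by rw [norm_mul]; ring
  simp only [e]
  rw [integral_sub hg (hp.const_mul c), integral_const_mul, integral_norm_sq_mul_trigPoly hf,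
    integral_norm_sq_trigPoly, hu, hT]
  ring

theorem integrable_norm_sq_sub_mul_norm_sq_trigPoly {f : ℝ → ℂ}
    (hf : MemLp f ⊤ normalizedMeasure) {n : ℕ} (u : EuclideanSpace ℂ (Fin n)) (c : ℝ) :
    Integrable (fun x => (‖f x‖ ^ 2 - c) * ‖trigPoly u x‖ ^ 2) normalizedMeasure := by
  have hp := ((memLp_top_trigPoly u).mono_exponent (p := 2) le_top).integrable_norm_pow two_ne_zero
  have hg := ((memLp_top_mul hf (memLp_top_trigPoly u)).mono_exponent
    (p := 2) le_top).integrable_norm_pow two_ne_zero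
  convert hg.sub (hp.const_mul c) using 2 with x
  simp only [norm_mul, Pi.sub_apply]
  ring

theorem integrable_sq_norm_sq_sub_mul_norm_sq_trigPoly {f : ℝ → ℂ}
    (hf : MemLp f ⊤ normalizedMeasure) {n : ℕ} (u : EuclideanSpace ℂ (Fin n)) (c : ℝ) :
    Integrable (fun x => (‖f x‖ ^ 2 - c) ^ 2 * ‖trigPoly u x‖ ^ 2) normalizedMeasure := by
  convert ((memLp_top_mul (memLp_top_norm_sq_sub hf c) (memLp_top_trigPoly u)).mono_exponent
    (p := 2) le_top).integrable_norm_pow two_ne_zero using 2 with x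
  rw [norm_mul, mul_pow, Complex.norm_real, Real.norm_eq_abs, sq_abs]

theorem integral_sq_norm_sq_sub_mul_norm_sq_trigPoly_le {f : ℝ → ℂ}
    (hf : MemLp f ⊤ normalizedMeasure) {F : ℝ} (hF : ∀ᵐ x ∂normalizedMeasure, ‖f x‖ ≤ F)
    {n : ℕ} {u : EuclideanSpace ℂ (Fin n)} {c : ℝ}
    (hc : (toeplitzOp n f).adjoint (toeplitzOp n f u) = (c : ℂ) • u) :
    ∫ x, (‖f x‖ ^ 2 - c) ^ 2 * ‖trigPoly u x‖ ^ 2 ∂normalizedMeasure ≤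
      2 * F ^ 2 * offBand f u + 2 * offBand (star f) (toeplitzOp n f u) := by
  have h1 := integral_norm_sq_mul_trigPoly_sub hf u
  have h2 := integral_norm_sq_mul_trigPoly_sub hf.star (toeplitzOp n f u)
  have i1 := (((memLp_top_mul hf (memLp_top_trigPoly u)).sub
    (memLp_top_trigPoly (toeplitzOp n f u))).mono_exponent
    (p := 2) le_top).integrable_norm_pow two_ne_zero
  have i2 := (((memLp_top_mul hf.star (memLp_top_trigPoly (toeplitzOp n f u))).sub
    (memLp_top_trigPoly (toeplitzOp n (star f) (toeplitzOp n f u)))).mono_exponent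
    (p := 2) le_top).integrable_norm_pow two_ne_zero
  simp only [Pi.sub_apply] at i1 i2
  rw [← h1, ← h2, ← integral_const_mul, ← integral_const_mul,
    ← integral_add (i1.const_mul _) (i2.const_mul _)]
  refine integral_mono_ae (integrable_sq_norm_sq_sub_mul_norm_sq_trigPoly hf u c)
    ((i1.const_mul _).add (i2.const_mul _)) ?_
  filter_upwards [hF] with x hx
  have hr : toeplitzOp n (star f) (toeplitzOp n f u) = (c : ℂ) • u := by rw [toeplitzOp_star, hc]
  rw [hr, trigPoly_smul]
  set r := trigPoly (toeplitzOp n f u) x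
  set p := trigPoly u x
  -- Inserting `r = p_{T u}` splits the error into two off-band remainders, since `c p = p_{T* T
  -- u}`.
  have e : ((‖f x‖ ^ 2 - c : ℝ) : ℂ) * p =
      star (f x) * (f x * p - r) + (star (f x) * r - c * p) := by
    have : star (f x) * f x = (‖f x‖ : ℂ) ^ 2 := Complex.conj_mul' (f x)
    push_cast
    rw [← this]
    ring
  have l : (‖f x‖ ^ 2 - c) ^ 2 * ‖p‖ ^ 2 = ‖((‖f x‖ ^ 2 - c : ℝ) : ℂ) * p‖ ^ 2 := by
    rw [norm_mul, mul_pow, Complex.norm_real, Real.norm_eq_abs, sq_abs]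
  rw [l, e]
  have t1 := norm_add_le (star (f x) * (f x * p - r)) (star (f x) * r - c * p)
  have t2 : ‖star (f x) * (f x * p - r)‖ ≤ F * ‖f x * p - r‖ := by
    rw [norm_mul, norm_star]
    gcongr
  have t3 : ‖star (f x) * (f x * p - r) + (star (f x) * r - c * p)‖ ^ 2 ≤
      (F * ‖f x * p - r‖ + ‖star (f x) * r - c * p‖) ^ 2 := by
    gcongr
    linarith
  have t4 := add_sq_le (a := F * ‖f x * p - r‖) (b := ‖star (f x) * r - c * p‖)
  refine t3.trans (t4.trans_eq ?_)
  simp only [Pi.star_apply]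
  ring

/-! ### Taylor comparison at each eigenvalue and conclusion. -/

theorem integrable_norm_sq_trigPoly_smul_comp {f : ℝ → ℂ} (hf : MemLp f ⊤ normalizedMeasure)
    {G : ℝ → ℂ} (hG : Continuous G) (hGc : HasCompactSupport G) {n : ℕ}
    (u : EuclideanSpace ℂ (Fin n)) :
    Integrable (fun x => ‖trigPoly u x‖ ^ 2 • G (‖f x‖ ^ 2)) normalizedMeasure := by
  obtain ⟨C, hC⟩ := hGc.exists_bound_of_continuous hG
  have hp := ((memLp_top_trigPoly u).mono_exponent (p := 2) le_top).integrable_norm_pow two_ne_zero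
  exact hp.smul_of_top_left (memLp_top_of_bound (hG.comp_aestronglyMeasurable (hf.1.norm.pow 2)) C
    (Filter.Eventually.of_forall fun x => hC _))

/-- Comparison of the average of `G(|f|²)` against `|p_u|²` with `G` at the eigenvalue. -/
theorem norm_integral_smul_comp_sub_le {f : ℝ → ℂ} (hf : MemLp f ⊤ normalizedMeasure) {F : ℝ}
    (hF : ∀ᵐ x ∂normalizedMeasure, ‖f x‖ ≤ F) {G : ℝ → ℂ} (hG : ContDiff ℝ 2 G)
    (hGc : HasCompactSupport G) {M₁ M₂ : ℝ} (h₁ : ∀ x, ‖deriv G x‖ ≤ M₁)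
    (h₂ : ∀ x, ‖deriv (deriv G) x‖ ≤ M₂) {n : ℕ} {u : EuclideanSpace ℂ (Fin n)} {c : ℝ}
    (hu : ‖u‖ = 1) (hc : (toeplitzOp n f).adjoint (toeplitzOp n f u) = (c : ℂ) • u) :
    ‖∫ x, ‖trigPoly u x‖ ^ 2 • G (‖f x‖ ^ 2) ∂normalizedMeasure - G c‖ ≤
      M₁ * offBand f u +
        M₂ * (2 * F ^ 2 * offBand f u + 2 * offBand (star f) (toeplitzOp n f u)) := by
  have hM₂ : 0 ≤ M₂ := (norm_nonneg _).trans (h₂ 0)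
  have hp := ((memLp_top_trigPoly u).mono_exponent (p := 2) le_top).integrable_norm_pow two_ne_zero
  have iG := integrable_norm_sq_trigPoly_smul_comp hf hG.continuous hGc u
  have ic : Integrable (fun x => ‖trigPoly u x‖ ^ 2 • G c) normalizedMeasure := hp.smul_const _
  have il := (integrable_norm_sq_sub_mul_norm_sq_trigPoly hf u c).smul_const (deriv G c)
  have e1 : ∫ x, ‖trigPoly u x‖ ^ 2 • G c ∂normalizedMeasure = G c := by
    rw [integral_smul_const, integral_norm_sq_trigPoly, hu]
    simp
  have e2 : ∫ x, ((‖f x‖ ^ 2 - c) * ‖trigPoly u x‖ ^ 2) • deriv G c ∂normalizedMeasure =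
      offBand f u • deriv G c := by
    rw [integral_smul_const, integral_norm_sq_sub_mul_norm_sq_trigPoly hf hu hc]
  have e3 : ∫ x, ‖trigPoly u x‖ ^ 2 • G (‖f x‖ ^ 2) ∂normalizedMeasure - G c =
      -- The linear Taylor term integrates exactly to `offBand f u • G'(c)`, leaving only the
      -- quadratic remainder to estimate.
      offBand f u • deriv G c + ∫ x, ‖trigPoly u x‖ ^ 2 •
        (G (‖f x‖ ^ 2) - G c - (‖f x‖ ^ 2 - c) • deriv G c) ∂normalizedMeasure := by
    rw [← e2]
    conv_lhs => rw [← e1]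
    rw [← integral_sub iG ic, ← sub_eq_iff_eq_add', ← integral_sub (by exact iG.sub ic) il]
    congr 1
    ext x
    simp only [smul_sub, smul_smul]
    rw [mul_comm (‖f x‖ ^ 2 - c)]
  have b : ‖∫ x, ‖trigPoly u x‖ ^ 2 •
        (G (‖f x‖ ^ 2) - G c - (‖f x‖ ^ 2 - c) • deriv G c) ∂normalizedMeasure‖ ≤
      ∫ x, M₂ * ((‖f x‖ ^ 2 - c) ^ 2 * ‖trigPoly u x‖ ^ 2) ∂normalizedMeasure := by
    refine norm_integral_le_of_norm_le
      ((integrable_sq_norm_sq_sub_mul_norm_sq_trigPoly hf u c).const_mul _)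
      (Filter.Eventually.of_forall fun x => ?_)
    rw [norm_smul, Real.norm_of_nonneg (by positivity), ← mul_assoc, mul_comm]
    exact mul_le_mul_of_nonneg_right (norm_sub_sub_smul_deriv_le hG h₂ _ _) (by positivity)
  rw [integral_const_mul] at b
  rw [e3]
  refine (norm_add_le _ _).trans (add_le_add ?_ (b.trans (mul_le_mul_of_nonneg_left
    (integral_sq_norm_sq_sub_mul_norm_sq_trigPoly_le hf hF hc) hM₂)))
  rw [norm_smul, Real.norm_of_nonneg (offBand_nonneg _ _), mul_comm]
  exact mul_le_mul_of_nonneg_right (h₁ c) (offBand_nonneg _ _)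

theorem theorem1 (f : ℝ → ℂ)
    (hf : MemLp f ⊤ (volume.restrict (Set.Icc (-Real.pi) Real.pi)))
    (hs : Summable (seminormTerm f))
    (G : ℝ → ℂ) (hG : ContDiff ℝ 3 G) (hGc : HasCompactSupport G)
    (n : ℕ) (hn : 1 ≤ n) :
    ‖(∑ j : Fin n, G (matrixSingularValue (toeplitzMatrix n f) j ^ 2))
        - (n : ℂ) / (2 * (Real.pi : ℂ)) * ∫ θ in (-Real.pi)..Real.pi, G (‖f θ‖ ^ 2)‖
      ≤ 2 * seminormSq f * (constC1 G + 2 * constC2 G * supNorm f ^ 2) := by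
  have hfν := memLp_top_normalizedMeasure hf
  have hF := ae_norm_le_supNorm hf
  have hrank : Module.finrank ℂ (EuclideanSpace ℂ (Fin n)) = n := finrank_euclideanSpace_fin
  have hsymm := (toeplitzOp n f).isSymmetric_adjoint_comp_self
  set b := hsymm.eigenvectorBasis hrank
  set ev := hsymm.eigenvalues hrank
  have hev (j : Fin n) : matrixSingularValue (toeplitzMatrix n f) j ^ 2 = ev j :=
    LinearMap.sq_singularValues_fin _ hrank j
  have hb (j : Fin n) :
      (toeplitzOp n f).adjoint (toeplitzOp n f (b j)) = (ev j : ℂ) • b j :=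
    hsymm.apply_eigenvectorBasis hrank j
  have hint : (n : ℂ) / (2 * (Real.pi : ℂ)) * ∫ θ in (-Real.pi)..Real.pi, G (‖f θ‖ ^ 2) =
      ∑ j, ∫ x, ‖trigPoly (b j) x‖ ^ 2 • G (‖f x‖ ^ 2) ∂normalizedMeasure := by
    rw [← integral_finsetSum _ fun j _ =>
      integrable_norm_sq_trigPoly_smul_comp hfν hG.continuous hGc (b j)]
    simp only [← Finset.sum_smul, sum_norm_sq_trigPoly]
    rw [integral_smul, integral_normalizedMeasure, Complex.real_smul, Complex.real_smul]
    push_cast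
    ring
  simp only [hev]
  rw [hint, ← Finset.sum_sub_distrib]
  have hd₁ := norm_deriv_le_constC1 hG hGc
  have hd₂ := norm_deriv_deriv_le_constC2 hG hGc
  have hc₁ : 0 ≤ constC1 G := (norm_nonneg _).trans (hd₁ 0)
  have hc₂ : 0 ≤ constC2 G := (norm_nonneg _).trans (hd₂ 0)
  have hS : 0 ≤ seminormSq f := tsum_nonneg (seminormTerm_nonneg f)
  -- `B` is the identity here, and `T` in `s₂`, where `‖T* y‖ ≤ ‖f‖_∞ ‖y‖` supplies the constant.
  have s₁ : ∑ j, offBand f (b j) ≤ seminormSq f := by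
    have h := sum_offBand_le hfν hs b LinearMap.id (C := 1) zero_le_one
      (fun y => by simp)
    simpa using h
  have s₂ : ∑ j, offBand (star f) (toeplitzOp n f (b j)) ≤ supNorm f ^ 2 * seminormSq f := by
    have hFs : ∀ᵐ x ∂normalizedMeasure, ‖(star f) x‖ ≤ supNorm f := by simpa using hF
    have h := sum_offBand_le hfν.star (summable_seminormTerm_star hs) b (toeplitzOp n f)
      (C := supNorm f ^ 2) (by positivity)
      (fun y => by rw [← toeplitzOp_star]; exact norm_sq_toeplitzOp_le hfν.star hFs y)
    rwa [seminormSq_star] at h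
  calc _ ≤ ∑ j, (constC1 G * offBand f (b j) + constC2 G * (2 * supNorm f ^ 2 * offBand f (b j) +
        2 * offBand (star f) (toeplitzOp n f (b j)))) := by
        refine norm_sum_le_of_le _ fun j _ => ?_
        rw [norm_sub_rev]
        exact norm_integral_smul_comp_sub_le hfν hF (hG.of_le (by norm_num)) hGc hd₁ hd₂
          (b.norm_eq_one j) (hb j)
    _ = constC1 G * ∑ j, offBand f (b j) + constC2 G * (2 * supNorm f ^ 2 * ∑ j, offBand f (b j) +
        2 * ∑ j, offBand (star f) (toeplitzOp n f (b j))) := by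
        simp only [Finset.mul_sum, Finset.sum_add_distrib, mul_add]
    _ ≤ constC1 G * seminormSq f + constC2 G * (2 * supNorm f ^ 2 * seminormSq f +
        2 * (supNorm f ^ 2 * seminormSq f)) := by gcongr
    -- The `constC2` terms agree exactly; the `constC1` term has a factor `2` to spare.
    _ ≤ _ := by nlinarith [mul_nonneg hc₁ hS]
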